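/- Let $N=N(d)$, $n=n(d)$ be positive-integer-valued for large $d$ with $N/d\to\psi_1\in(0,\infty)$ and $n/d\to\psi_2\in(0,\infty)$ as $d\to\infty$. Fix constants $C\in\mathbb{R}$ and $C_0>0$. For each $d$ let $W=W_d\in\mathbb{R}^{N\times d}$ be a deterministic matrix with rows $w_1,\dots,w_N$ which, for all large $d$, satisfies $\|w_\ell\|_2=1$ for all $\ell$ and $$\|W\|_{\mathrm{op}}\le \sqrt{N/d}+C,\qquad |\langle w_\ell,w_k\rangle|\le \frac{\log d}{\sqrt d}\quad\text{for all }\ell\ne k .$$ Let $x_1,\dots,x_n$ be i.i.d. $\mathsf{N}(0,I_d)$ vectors, and put $$\mathcal{C}_\theta=\{\theta\in\mathbb{R}^N:\ \|\theta\|_\infty\le C_0\sqrt{\log(d)/d},\ \|\theta\|_2\le C_0\},\qquad \eta_i(\theta)=\|W^{\mathsf T}\,\mathrm{diag}(\mathbb{I}(Wx_i>0))\,\theta\|_2,$$ $$\nu_i(\theta;\gamma)=\mathbb{I}\big(|\eta_i(\theta)^2-\mathbb{E}[\eta_i(\theta)^2]|>\gamma\big),$$ where $\mathbb{I}(Wx_i>0)\in\{0,1\}^N$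 is taken entrywise and the expectation is over $x_i$. All probabilities below are over $x_1,\dots,x_n$. (a) For every sequence $\gamma_d$ such that $1/\gamma_d=e^{r_d}$ for all large $d$, where $r_d/\sqrt{\log d}\to 0$, $$\sup_{\theta\in\mathcal{C}_\theta}\frac1n\sum_{i=1}^n\nu_i(\theta;\gamma_d)=O_{d,\mathbb{P}}\big(\log(d\gamma_d^2)^{-1/2}\big).$$ (b) In particular, $$\sup_{\theta\in\mathcal{C}_\theta}\frac1n\sum_{i=1}^n\nu_i\big(\theta;\tfrac1{\log d}\big)=o_{d,\mathbb{P}}(1).$$ Here $f(d)=O_{d,\mathbb{P}}(g(d))$ means that for every $\varepsilon>0$ there are $K_\varepsilon>0$ and $d_\varepsilon$ with $\mathbb{P}(|f(d)/g(d)|>K_\varepsilon)\le\varepsilon$ for all $d\ge d_\varepsilon$, and $f(d)=o_{d,\mathbb{P}}(g(d))$ means that $f(d)/g(d)\to0$ in probability. -/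

import Mathlib

open MeasureTheory ProbabilityTheory Filter Topology Asymptotics
open scoped Matrix

noncomputable section

namespace RandomFeatures

/-- The `ℓ₂ → ℓ₂` operator norm of a rectangular real matrix. -/
def opNorm {N d : ℕ} (W : Matrix (Fin N) (Fin d) ℝ) : ℝ :=
  ‖LinearMap.toContinuousLinearMap (Matrix.toEuclideanLin W)‖

/-- The rows `w_ℓ` of `W` have unit Euclidean norm. -/
def UnitRows {N d : ℕ} (W : Matrix (Fin N) (Fin d) ℝ) : Prop :=
  ∀ l, W l ⬝ᵥ W l = 1

/-- The event `E_W` with constant `C`: `‖W‖ ≤ √(N/d) + C`, and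
`|⟨w_ℓ, w_k⟩| ≤ log d / √d` for all `ℓ ≠ k`. -/
def EventW {N d : ℕ} (C : ℝ) (W : Matrix (Fin N) (Fin d) ℝ) : Prop :=
  opNorm W ≤ √((N : ℝ) / d) + C ∧
    ∀ l k, l ≠ k → |W l ⬝ᵥ W k| ≤ Real.log d / √(d : ℝ)

/-- The parameter set `C_θ ⊆ ℝ^N`:
`‖θ‖_∞ ≤ C₀ √(log d / d)` and `‖θ‖₂ ≤ C₀`. -/
def paramSet (N d : ℕ) (C₀ : ℝ) : Set (EuclideanSpace ℝ (Fin N)) :=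
  {θ | (∀ l, |θ l| ≤ C₀ * √(Real.log d / d)) ∧ ‖θ‖ ≤ C₀}

/-- The vector `𝕀(W x > 0) ∈ {0,1}^N`. -/
def activation {N d : ℕ} (W : Matrix (Fin N) (Fin d) ℝ) (x : EuclideanSpace ℝ (Fin d)) :
    Fin N → ℝ :=
  fun l => if 0 < (W *ᵥ x.ofLp) l then 1 else 0

/-- `η(θ) = ‖Wᵀ diag(𝕀(W x > 0)) θ‖₂` for the data point `x`. -/
def eta {N d : ℕ} (W : Matrix (Fin N) (Fin d) ℝ) (x : EuclideanSpace ℝ (Fin d))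
    (θ : EuclideanSpace ℝ (Fin N)) : ℝ :=
  ‖(WithLp.toLp 2 ((Wᵀ * Matrix.diagonal (activation W x)) *ᵥ θ.ofLp) :
    EuclideanSpace ℝ (Fin d))‖

/-- `ν(θ; γ) = 𝕀(|η(θ)² - E[η(θ)²]| > γ)` for the random data point `x`, as a random variable.
The expectation is over `x`, with `W` fixed. -/
def nu {N d : ℕ} {Ω : Type*} [MeasurableSpace Ω] (P : Measure Ω)
    (W : Matrix (Fin N) (Fin d) ℝ) (x : Ω → EuclideanSpace ℝ (Fin d))
    (θ : EuclideanSpace ℝ (Fin N)) (γ : ℝ) (ω : Ω) : ℝ :=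
  if γ < |eta W (x ω) θ ^ 2 - ∫ ω', eta W (x ω') θ ^ 2 ∂P| then 1 else 0

/-- `sup_{θ ∈ C_θ} (1/n) ∑ᵢ νᵢ(θ; γ)`. -/
def supFraction {N d n : ℕ} {Ω : Type*} [MeasurableSpace Ω] (P : Measure Ω)
    (W : Matrix (Fin N) (Fin d) ℝ) (X : Fin n → Ω → EuclideanSpace ℝ (Fin d))
    (C₀ γ : ℝ) (ω : Ω) : ℝ :=
  ⨆ θ : paramSet N d C₀, (1 / (n : ℝ)) * ∑ i, nu P W (X i) θ γ ω

/-- `f(d) = O_{d,P}(g(d))`; the probability space may vary with `d`. -/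
def IsBigOInProbability {Ω : ℕ → Type*} [∀ d, MeasurableSpace (Ω d)]
    (P : ∀ d, Measure (Ω d)) (f : ∀ d, Ω d → ℝ) (g : ℕ → ℝ) : Prop :=
  ∀ ε : ℝ, 0 < ε → ∃ K : ℝ, 0 < K ∧ ∃ d₀ : ℕ, ∀ d, d₀ ≤ d →
    P d {ω | K < |f d ω / g d|} ≤ ENNReal.ofReal ε

/-- `f(d) = o_{d,P}(g(d))`: `f(d) / g(d)` converges to `0` in probability. -/
def IsLittleOInProbability {Ω : ℕ → Type*} [∀ d, MeasurableSpace (Ω d)]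
    (P : ∀ d, Measure (Ω d)) (f : ∀ d, Ω d → ℝ) (g : ℕ → ℝ) : Prop :=
  ∀ ε : ℝ, 0 < ε → Tendsto (fun d => P d {ω | ε < |f d ω / g d|}) atTop (𝓝 0)

/-- `1 / γ_d = e^{o(√(log d))}`, for a sequence `γ_d`, positive for all large `d`. -/
def InvIsExpLittleOSqrtLog (γ : ℕ → ℝ) : Prop :=
  ∃ r : ℕ → ℝ, r =o[atTop] (fun d : ℕ => √(Real.log d)) ∧
    ∀ᶠ d in atTop, 1 / γ d = Real.exp (r d)

end RandomFeatures

end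

/-! Write q = √(log d), so that d = e^{q²}. For a fixed θ, η(θ)² is discontinuous in x, as a
coordinate of the mask can flip wherever ⟨w_l, x⟩ = 0. Replacing the indicator by a smooth step of
width s² gives a function whose gradient is O(‖θ‖_∞ / s²), small thanks to the sup-norm constraint.
An L¹ Gaussian Poincaré inequality (`lintegral_enorm_sub_stdGaussian_le`) controls its fluctuations,
and anti-concentration of ⟨w_l, x⟩ near 0 makes the L¹ smoothing error O(s)
(`lintegral_enorm_eta_sq_sub_smooth_le`). Markov's inequality with s = e^{-q²/8} then shows that one
sample is bad with probability at most e^{-q²/16}, a negative power of d, as long as γ ≥ e^{-q}.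

That tail cannot survive a union bound over a net of e^{O(qd)} parameters, but independence
amplifies it: δn bad samples occur together with probability at most 2^n e^{-δnq²/16}
(`measure_le_sum_indicator_le`). For δ = K/q the exponent is of order Kqd, the same order as the
entropy of a net at scale e^{-q}, so a large K wins (`union_bound_le`). This balance produces the
rate 1/√(log d). Both parts follow from `exists_tendsto_measure_lt_supFraction`. -/

namespace RandomFeatures

/-! ### Gaussian tools: an L¹ Poincaré inequality and anti-concentration. -/

section Gaussian

open scoped ENNReal

variable {E : Type*} [NormedAddCommGroup E] [InnerProductSpace ℝ E] [FiniteDimensional ℝ E]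
  [MeasurableSpace E] [BorelSpace E]

/-- `L` is centred with variance ‖L‖², and the L¹ norm is at most the L² norm under a probability
measure. -/
lemma lintegral_enorm_dual_stdGaussian_le (L : StrongDual ℝ E) :
    ∫⁻ y, ‖L y‖ₑ ∂(stdGaussian E) ≤ ‖L‖ₑ := by
  have hmem : MemLp L 2 (stdGaussian E) :=
    IsGaussian.memLp_dual (stdGaussian E) L 2 (by simp)
  have h1 : eLpNorm L 1 (stdGaussian E) ≤ eLpNorm L 2 (stdGaussian E) :=
    eLpNorm_le_eLpNorm_of_exponent_le (by norm_num) hmem.1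
  rw [eLpNorm_one_eq_lintegral_enorm] at h1
  refine h1.trans ?_
  have hvar := variance_dual_stdGaussian L
  rw [variance_of_integral_eq_zero L.continuous.aemeasurable
    (integral_strongDual_stdGaussian L)] at hvar
  rw [hmem.eLpNorm_eq_integral_rpow_norm (by norm_num) (by norm_num)]
  simp only [ENNReal.toReal_ofNat, Real.norm_eq_abs]
  rw [← ofReal_norm]
  refine ENNReal.ofReal_le_ofReal ?_
  have : (fun a => |L a| ^ (2 : ℝ)) = fun a => L a ^ 2 := by
    ext a; rw [Real.rpow_two, sq_abs]
  rw [this, hvar, ← Real.rpow_two, ← Real.rpow_mul (norm_nonneg _)]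
  norm_num

/-- An `L¹` Gaussian Poincaré inequality, for two independent copies. -/
lemma lintegral_enorm_sub_stdGaussian_le {f : E → ℝ} (hf : ContDiff ℝ 1 f) {L : ℝ}
    (hL : ∀ x, ‖fderiv ℝ f x‖ ≤ L) :
    ∫⁻ z, ‖f z.1 - f z.2‖ₑ ∂((stdGaussian E).prod (stdGaussian E)) ≤
      ENNReal.ofReal (Real.pi / 2 * L) := by
  set μ := stdGaussian E with hμ
  -- The path t ↦ cos t • z.1 + sin t • z.2 joins z.1 to z.2, and its velocity is the second
  -- component of the rotated pair. Rotation preserves the law of two independent standard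
  -- Gaussians, so at each t the derivative of f along the path is distributed as `fderiv ℝ f z.1
  -- z.2`.
  let R : ℝ → E × E → E × E := fun t z => ContinuousLinearMap.rotation t z
  have hR1 : ∀ t z, R t z = (Real.cos t • z.1 + Real.sin t • z.2,
      -Real.sin t • z.1 + Real.cos t • z.2) := fun t z => rfl
  let G : E × E → ℝ≥0∞ := fun z => ‖fderiv ℝ f z.1 z.2‖ₑ
  have hfd : Continuous (fderiv ℝ f) := hf.continuous_fderiv (by norm_num)
  have hGc : Continuous fun z : E × E => fderiv ℝ f z.1 z.2 :=
    (hfd.comp continuous_fst).clm_apply continuous_snd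
  have hG : Measurable G := hGc.measurable.enorm
  have hRc : Continuous fun q : (E × E) × ℝ => R q.2 q.1 := by
    simp only [hR1]; fun_prop
  have hpt : ∀ z : E × E, ‖f z.1 - f z.2‖ₑ ≤
      ∫⁻ t in Set.Icc 0 (Real.pi / 2), G (R t z) := by
    intro z
    have hder : ∀ t, HasDerivAt (fun t => (R t z).1) (R t z).2 t := by
      intro t
      simp only [hR1]
      exact ((Real.hasDerivAt_cos t).smul_const z.1).add ((Real.hasDerivAt_sin t).smul_const z.2)
    have hcd : ContDiff ℝ 1 fun t => (R t z).1 := by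
      simp only [hR1]
      exact (Real.contDiff_cos.smul contDiff_const).add (Real.contDiff_sin.smul contDiff_const)
    have h := enorm_sub_le_lintegral_deriv_of_contDiffOn_Icc (f := fun t => f (R t z).1)
      (a := 0) (b := Real.pi / 2) ((hf.comp hcd).contDiffOn) (by positivity)
    have h0 : (R 0 z).1 = z.1 := by simp [hR1]
    have h1 : (R (Real.pi / 2) z).1 = z.2 := by simp [hR1]
    simp only [h0, h1] at h
    rw [enorm_sub_rev]
    refine h.trans (le_of_eq ?_)
    refine lintegral_congr fun t => ?_
    have : HasDerivAt (fun t => f (R t z).1) (fderiv ℝ f (R t z).1 (R t z).2) t :=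
      ((hf.differentiable (by norm_num)).differentiableAt.hasFDerivAt).comp_hasDerivAt t (hder t)
    rw [this.deriv]
  have hrot : ∀ t, ∫⁻ z, G (R t z) ∂(μ.prod μ) = ∫⁻ z, G z ∂(μ.prod μ) := by
    intro t
    have hmap : (μ.prod μ).map (ContinuousLinearMap.rotation t) = μ.prod μ :=
      IsGaussian.map_rotation_eq_self_of_forall_strongDual_eq_zero
        (fun L => integral_strongDual_stdGaussian L) t
    conv_rhs => rw [← hmap]
    rw [lintegral_map hG (ContinuousLinearMap.measurable _)]
  have hGle : ∫⁻ z, G z ∂(μ.prod μ) ≤ ENNReal.ofReal L := by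
    rw [lintegral_prod _ hG.aemeasurable]
    -- With x frozen, the inner integrand is a fixed linear form of an independent Gaussian.
    calc ∫⁻ x, ∫⁻ y, G (x, y) ∂μ ∂μ ≤ ∫⁻ _x, ENNReal.ofReal L ∂μ := by
          refine lintegral_mono fun x =>
            (lintegral_enorm_dual_stdGaussian_le (fderiv ℝ f x)).trans ?_
          rw [← ofReal_norm]
          exact ENNReal.ofReal_le_ofReal (hL x)
      _ = ENNReal.ofReal L := by simp
  calc ∫⁻ z, ‖f z.1 - f z.2‖ₑ ∂(μ.prod μ)
      ≤ ∫⁻ z, (∫⁻ t in Set.Icc 0 (Real.pi / 2), G (R t z)) ∂(μ.prod μ) := lintegral_mono hpt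
    _ = ∫⁻ t in Set.Icc 0 (Real.pi / 2), ∫⁻ z, G (R t z) ∂(μ.prod μ) := by
        exact lintegral_lintegral_swap (f := fun z t => G (R t z))
          (hG.comp hRc.measurable).aemeasurable
    _ = ∫⁻ _t in Set.Icc 0 (Real.pi / 2), ∫⁻ z, G z ∂(μ.prod μ) := by simp only [hrot]
    _ ≤ ∫⁻ _t in Set.Icc 0 (Real.pi / 2), ENNReal.ofReal L := lintegral_mono fun _ => hGle
    _ = ENNReal.ofReal (Real.pi / 2 * L) := by
        rw [setLIntegral_const, Real.volume_Icc, sub_zero, mul_comm,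
          ENNReal.ofReal_mul (by positivity)]

lemma stdGaussian_map_inner {w : E} (hw : ‖w‖ = 1) :
    (stdGaussian E).map (fun x => inner ℝ w x) = gaussianReal 0 1 := by
  have h := IsGaussian.map_eq_gaussianReal (μ := stdGaussian E) (innerSL ℝ w)
  rw [integral_strongDual_stdGaussian, variance_dual_stdGaussian, innerSL_apply_norm, hw] at h
  simpa using h

/-- The standard Gaussian density is at most 1. -/
lemma gaussianReal_Ioo_le (τ : ℝ) :
    gaussianReal 0 1 (Set.Ioo 0 τ) ≤ ENNReal.ofReal τ := by
  rw [gaussianReal_apply _ (by norm_num)]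
  calc ∫⁻ x in Set.Ioo 0 τ, gaussianPDF 0 1 x ≤ ∫⁻ _x in Set.Ioo 0 τ, 1 := by
        refine lintegral_mono fun x => ?_
        rw [gaussianPDF, gaussianPDFReal]
        refine ENNReal.ofReal_le_one.2 ?_
        have h1 : (√(2 * Real.pi * ((1 : NNReal) : ℝ)))⁻¹ ≤ 1 := by
          refine inv_le_one_of_one_le₀ (Real.one_le_sqrt.2 ?_)
          have := Real.pi_gt_three
          simp; linarith
        have h2 : Real.exp (-(x - 0) ^ 2 / (2 * ((1 : NNReal) : ℝ))) ≤ 1 := by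
          refine Real.exp_le_one_iff.2 ?_
          rw [neg_div]
          exact neg_nonpos.2 (by positivity)
        exact mul_le_one₀ h1 (Real.exp_pos _).le h2
    _ = ENNReal.ofReal τ := by simp

lemma stdGaussian_inner_Ioo_le {w : E} (hw : ‖w‖ = 1) (τ : ℝ) :
    stdGaussian E {x | inner ℝ w x ∈ Set.Ioo 0 τ} ≤ ENNReal.ofReal τ := by
  have hm : Measurable fun x : E => inner ℝ w x := (by fun_prop : Continuous _).measurable
  have := Measure.map_apply (μ := stdGaussian E) hm (measurableSet_Ioo (a := (0 : ℝ)) (b := τ))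
  rw [stdGaussian_map_inner hw] at this
  exact this.symm.le.trans (gaussianReal_Ioo_le τ)

end Gaussian

/-! ### η² as a function of the mask and of θ, with Lipschitz bounds in each. -/

section MaskedNorm

variable {N d : ℕ}

/-- The linear map `x ↦ W x` between Euclidean spaces. -/
noncomputable def rowMap (W : Matrix (Fin N) (Fin d) ℝ) :
    EuclideanSpace ℝ (Fin d) →L[ℝ] EuclideanSpace ℝ (Fin N) :=
  LinearMap.toContinuousLinearMap (Matrix.toEuclideanLin W)

lemma rowMap_apply (W : Matrix (Fin N) (Fin d) ℝ) (x : EuclideanSpace ℝ (Fin d)) (l : Fin N) :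
    rowMap W x l = (W *ᵥ x.ofLp) l := rfl

lemma rowMap_apply_eq_inner (W : Matrix (Fin N) (Fin d) ℝ) (x : EuclideanSpace ℝ (Fin d))
    (l : Fin N) : rowMap W x l = inner ℝ (WithLp.toLp 2 (W l) : EuclideanSpace ℝ (Fin d)) x := by
  rw [rowMap_apply, PiLp.inner_apply]
  simp [Matrix.mulVec, dotProduct, mul_comm]

lemma UnitRows.norm_eq_one {W : Matrix (Fin N) (Fin d) ℝ} (hW : UnitRows W) (l : Fin N) :
    ‖(WithLp.toLp 2 (W l) : EuclideanSpace ℝ (Fin d))‖ = 1 := by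
  rw [EuclideanSpace.norm_eq, Real.sqrt_eq_one, ← hW l]
  simp [dotProduct, sq]

/-- The coordinatewise product of `a` and `θ`, as a Euclidean vector. -/
def mask (θ : EuclideanSpace ℝ (Fin N)) (a : Fin N → ℝ) : EuclideanSpace ℝ (Fin N) :=
  WithLp.toLp 2 fun l => a l * θ l

lemma norm_mask_sq (θ : EuclideanSpace ℝ (Fin N)) (a : Fin N → ℝ) :
    ‖mask θ a‖ ^ 2 = ∑ l, (a l * θ l) ^ 2 := by
  rw [EuclideanSpace.real_norm_sq_eq]; rfl

lemma norm_mask_le (θ : EuclideanSpace ℝ (Fin N)) {a : Fin N → ℝ} (ha : ∀ l, |a l| ≤ 1) :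
    ‖mask θ a‖ ≤ ‖θ‖ := by
  refine le_of_sq_le_sq ?_ (norm_nonneg _)
  rw [norm_mask_sq, EuclideanSpace.real_norm_sq_eq]
  refine Finset.sum_le_sum fun l _ => ?_
  rw [mul_pow]
  exact mul_le_of_le_one_left (sq_nonneg _) ((sq_le_one_iff_abs_le_one _).2 (ha l))

lemma mask_sub_left (θ θ' : EuclideanSpace ℝ (Fin N)) (a : Fin N → ℝ) :
    mask (θ - θ') a = mask θ a - mask θ' a := by
  ext l; simp [mask, mul_sub]

lemma mask_sub_right (θ : EuclideanSpace ℝ (Fin N)) (a b : Fin N → ℝ) :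
    mask θ (a - b) = mask θ a - mask θ b := by
  ext l; simp [mask, sub_mul]

/-- `‖Wᵀ diag(a) θ‖²`, as a function of the weights `a`. -/
noncomputable def maskedSq (W : Matrix (Fin N) (Fin d) ℝ) (θ : EuclideanSpace ℝ (Fin N))
    (a : Fin N → ℝ) : ℝ :=
  ‖(rowMap W).adjoint (mask θ a)‖ ^ 2

lemma eta_sq_eq_maskedSq (W : Matrix (Fin N) (Fin d) ℝ) (x : EuclideanSpace ℝ (Fin d))
    (θ : EuclideanSpace ℝ (Fin N)) : eta W x θ ^ 2 = maskedSq W θ (activation W x) := by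
  have hadj : ∀ v, (rowMap W).adjoint v = WithLp.toLp 2 (Wᵀ *ᵥ v.ofLp) := by
    intro v
    refine ext_inner_right ℝ fun y => ?_
    rw [ContinuousLinearMap.adjoint_inner_left]
    simp only [PiLp.inner_apply, RCLike.inner_apply, conj_trivial, rowMap_apply]
    change (W *ᵥ y.ofLp) ⬝ᵥ v.ofLp = y.ofLp ⬝ᵥ (Wᵀ *ᵥ v.ofLp)
    rw [Matrix.dotProduct_mulVec, Matrix.vecMul_transpose]
  rw [eta, maskedSq, hadj, ← Matrix.mulVec_mulVec]
  congr 5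
  ext l
  simp [Matrix.mulVec_diagonal, mask]

lemma abs_activation_le_one (W : Matrix (Fin N) (Fin d) ℝ) (x : EuclideanSpace ℝ (Fin d))
    (l : Fin N) : |activation W x l| ≤ 1 := by
  unfold activation; split_ifs <;> simp

lemma abs_norm_sq_sub_norm_sq_le {F : Type*} [SeminormedAddCommGroup F] {u v : F} {r : ℝ}
    (hu : ‖u‖ ≤ r) (hv : ‖v‖ ≤ r) : |‖u‖ ^ 2 - ‖v‖ ^ 2| ≤ 2 * r * ‖u - v‖ := by
  rw [sq_sub_sq, abs_mul]
  refine mul_le_mul ?_ (abs_norm_sub_norm_le u v) (abs_nonneg _)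
    (by linarith [norm_nonneg u])
  rw [abs_of_nonneg (by positivity)]; linarith

variable {W : Matrix (Fin N) (Fin d) ℝ} {B C₀ : ℝ}

lemma norm_adjoint_rowMap_le (hB : opNorm W ≤ B) (v : EuclideanSpace ℝ (Fin N)) :
    ‖(rowMap W).adjoint v‖ ≤ B * ‖v‖ := by
  refine ((rowMap W).adjoint.le_opNorm v).trans ?_
  rw [LinearIsometryEquiv.norm_map]
  exact mul_le_mul_of_nonneg_right hB (norm_nonneg _)

lemma opNorm_bound_nonneg (hB : opNorm W ≤ B) : 0 ≤ B := (norm_nonneg _).trans hB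

/-- Uniform in x, so that both η² and its mean can be moved from θ to a nearby net point. -/
lemma abs_eta_sq_sub_le (hB : opNorm W ≤ B) {θ θ' : EuclideanSpace ℝ (Fin N)}
    (hθ : ‖θ‖ ≤ C₀) (hθ' : ‖θ'‖ ≤ C₀) (x : EuclideanSpace ℝ (Fin d)) :
    |eta W x θ ^ 2 - eta W x θ' ^ 2| ≤ 2 * B ^ 2 * C₀ * ‖θ - θ'‖ := by
  have hB0 := opNorm_bound_nonneg hB
  have key : ∀ θ : EuclideanSpace ℝ (Fin N),
      ‖(rowMap W).adjoint (mask θ (activation W x))‖ ≤ B * ‖θ‖ := fun θ =>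
    (norm_adjoint_rowMap_le hB _).trans
      (mul_le_mul_of_nonneg_left (norm_mask_le θ (abs_activation_le_one W x)) hB0)
  rw [eta_sq_eq_maskedSq, eta_sq_eq_maskedSq, maskedSq, maskedSq]
  refine (abs_norm_sq_sub_norm_sq_le (r := B * C₀)
    ((key θ).trans (by gcongr)) ((key θ').trans (by gcongr))).trans ?_
  rw [← map_sub, ← mask_sub_left]
  have hC : 0 ≤ C₀ := (norm_nonneg _).trans hθ
  calc _ ≤ 2 * (B * C₀) * (B * ‖θ - θ'‖) := by gcongr; exact key _
    _ = _ := by ring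

lemma eta_sq_le (hB : opNorm W ≤ B) {θ : EuclideanSpace ℝ (Fin N)}
    (hθ : ‖θ‖ ≤ C₀) (x : EuclideanSpace ℝ (Fin d)) : eta W x θ ^ 2 ≤ (B * C₀) ^ 2 := by
  have hB0 := opNorm_bound_nonneg hB
  rw [eta_sq_eq_maskedSq, maskedSq]
  refine pow_le_pow_left₀ (norm_nonneg _) ((norm_adjoint_rowMap_le hB _).trans ?_) 2
  exact mul_le_mul_of_nonneg_left ((norm_mask_le θ (abs_activation_le_one W x)).trans hθ) hB0

lemma measurable_activation (W : Matrix (Fin N) (Fin d) ℝ) (l : Fin N) :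
    Measurable fun x => activation W x l := by
  have : Measurable fun x : EuclideanSpace ℝ (Fin d) => rowMap W x l :=
    (by fun_prop : Continuous fun x : EuclideanSpace ℝ (Fin d) => rowMap W x l).measurable
  exact Measurable.ite (measurableSet_lt measurable_const this) measurable_const measurable_const

lemma measurable_eta_sq (W : Matrix (Fin N) (Fin d) ℝ) (θ : EuclideanSpace ℝ (Fin N)) :
    Measurable fun x => eta W x θ ^ 2 := by
  simp only [eta_sq_eq_maskedSq, maskedSq, mask]
  have : Continuous fun a : Fin N → ℝ =>
      ‖(rowMap W).adjoint (WithLp.toLp 2 fun l => a l * θ l)‖ ^ 2 := by fun_prop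
  exact this.measurable.comp (measurable_pi_lambda _ (measurable_activation W))

/-- Measures the cost of replacing the 0-1 mask by a smooth one. -/
lemma abs_maskedSq_sub_le (hB : opNorm W ≤ B) {θ : EuclideanSpace ℝ (Fin N)} (hθ : ‖θ‖ ≤ C₀)
    {a b : Fin N → ℝ} (ha : ∀ l, |a l| ≤ 1) (hb : ∀ l, |b l| ≤ 1) :
    |maskedSq W θ a - maskedSq W θ b| ≤ 2 * B ^ 2 * C₀ * ‖mask θ (a - b)‖ := by
  have hB0 := opNorm_bound_nonneg hB
  have hC : 0 ≤ C₀ := (norm_nonneg _).trans hθ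
  have key : ∀ a : Fin N → ℝ, (∀ l, |a l| ≤ 1) → ‖(rowMap W).adjoint (mask θ a)‖ ≤ B * C₀ :=
    fun a ha => (norm_adjoint_rowMap_le hB _).trans
      (mul_le_mul_of_nonneg_left ((norm_mask_le θ ha).trans hθ) hB0)
  rw [maskedSq, maskedSq]
  refine (abs_norm_sq_sub_norm_sq_le (key a ha) (key b hb)).trans ?_
  rw [← map_sub, ← mask_sub_right]
  calc _ ≤ 2 * (B * C₀) * (B * ‖mask θ (a - b)‖) := by
        gcongr; exact norm_adjoint_rowMap_le hB _
    _ = _ := by ring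

end MaskedNorm

/-! ### Smoothing the indicator: gradient bound and L¹ error. -/

section Smoothing

variable {N d : ℕ} {W : Matrix (Fin N) (Fin d) ℝ} {B C₀ : ℝ}

lemma contDiff_maskedSq_comp (W : Matrix (Fin N) (Fin d) ℝ) (θ : EuclideanSpace ℝ (Fin N))
    {φ : ℝ → ℝ} (hφ : ContDiff ℝ 1 φ) :
    ContDiff ℝ 1 fun x => maskedSq W θ fun l => φ (rowMap W x l) := by
  unfold maskedSq mask
  refine ((ContinuousLinearMap.contDiff _).comp ?_).norm_sq ℝ
  rw [contDiff_euclidean]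
  intro l
  have : ContDiff ℝ 1 fun x : EuclideanSpace ℝ (Fin d) => rowMap W x l :=
    ((EuclideanSpace.proj l : EuclideanSpace ℝ (Fin N) →L[ℝ] ℝ).comp (rowMap W)).contDiff
  exact (hφ.comp this).mul contDiff_const

/-- With A = `rowMap W`, the derivative along h is 2⟨A A* m, m'⟩, where m' has coordinates θ_l
φ'((Ax)_l) (Ah)_l. Pulling |θ_l| ≤ t out in sup norm leaves ‖Ah‖, whence ‖m'‖ ≤ MtB‖h‖; the other
two factors B come from A A*. -/
lemma norm_fderiv_maskedSq_comp_le (hB : opNorm W ≤ B) {θ : EuclideanSpace ℝ (Fin N)}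
    (hθ : ‖θ‖ ≤ C₀) {t : ℝ} (ht : ∀ l, |θ l| ≤ t) (ht0 : 0 ≤ t)
    {φ : ℝ → ℝ} (hφ : ContDiff ℝ 1 φ)
    (hφ1 : ∀ z, |φ z| ≤ 1) {M : ℝ} (hφM : ∀ z, |deriv φ z| ≤ M) (x : EuclideanSpace ℝ (Fin d)) :
    ‖fderiv ℝ (fun x => maskedSq W θ fun l => φ (rowMap W x l)) x‖ ≤
      2 * B ^ 3 * C₀ * M * t := by
  have hB0 := opNorm_bound_nonneg hB
  have hC : 0 ≤ C₀ := (norm_nonneg _).trans hθ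
  have hM : 0 ≤ M := (abs_nonneg _).trans (hφM 0)
  refine ContinuousLinearMap.opNorm_le_bound _ (by positivity) fun h => ?_
  set A := rowMap W with hA
  set m : ℝ → EuclideanSpace ℝ (Fin N) := fun s => mask θ fun l => φ (A (x + s • h) l) with hm
  set m' : EuclideanSpace ℝ (Fin N) := mask θ fun l => deriv φ (A x l) * A h l with hm'
  have hmd : HasDerivAt m m' 0 := by
    refine (PiLp.continuousLinearEquiv 2 ℝ fun _ : Fin N => ℝ).symm.hasFDerivAt.comp_hasDerivAt 0
      (f := fun s l => φ (A (x + s • h) l) * θ l)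
      (f' := fun l => deriv φ (A x l) * A h l * θ l) (hasDerivAt_pi.2 fun l => ?_)
    have h1 : HasDerivAt (fun s : ℝ => A (x + s • h) l) (A h l) 0 := by
      have : (fun s : ℝ => A (x + s • h) l) = fun s => A x l + s * A h l := by
        ext s; simp
      rw [this]
      simpa using ((hasDerivAt_id (0 : ℝ)).mul_const (A h l)).const_add (A x l)
    have h2 : HasDerivAt φ (deriv φ (A x l)) (A (x + (0 : ℝ) • h) l) := by
      simpa using ((hφ.differentiable (by norm_num)).differentiableAt (x := A x l)).hasDerivAt
    exact (h2.comp 0 h1).mul_const (θ l)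
  have hu : HasDerivAt (fun s => ‖A.adjoint (m s)‖ ^ 2)
      (2 * inner ℝ (A.adjoint (m 0)) (A.adjoint m')) 0 :=
    (A.adjoint.hasFDerivAt.comp_hasDerivAt 0 hmd).norm_sq
  have hline : HasDerivAt (fun s : ℝ => x + s • h) h 0 := by
    simpa using ((hasDerivAt_id (0 : ℝ)).smul_const h).const_add x
  have hf : HasDerivAt (fun s => ‖A.adjoint (m s)‖ ^ 2)
      (fderiv ℝ (fun x => maskedSq W θ fun l => φ (rowMap W x l)) x h) 0 := by
    have hd := ((contDiff_maskedSq_comp W θ hφ).differentiable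
      (by norm_num)).differentiableAt (x := x + (0 : ℝ) • h)
    have := hd.hasFDerivAt.comp_hasDerivAt (0 : ℝ) hline
    simp only [zero_smul, add_zero] at this
    exact this
  -- The chain rule at x and direct differentiation along the line x + s • h compute the same
  -- derivative.
  rw [hf.unique hu, ContinuousLinearMap.adjoint_inner_right]
  set u := A.adjoint (m 0) with hu_def
  have hun : ‖u‖ ≤ B * C₀ := (norm_adjoint_rowMap_le hB _).trans
    (mul_le_mul_of_nonneg_left ((norm_mask_le θ fun l => hφ1 _).trans hθ) hB0)
  have hAn : ∀ y, ‖A y‖ ≤ B * ‖y‖ := fun y =>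
    (A.le_opNorm y).trans (mul_le_mul_of_nonneg_right hB (norm_nonneg _))
  have hm'n : ‖m'‖ ≤ M * t * ‖A h‖ := by
    refine le_of_sq_le_sq ?_ (by positivity)
    rw [hm', norm_mask_sq, mul_pow, EuclideanSpace.real_norm_sq_eq, Finset.mul_sum]
    refine Finset.sum_le_sum fun l _ => ?_
    have h1 : (deriv φ (A x l) * A h l * θ l) ^ 2 =
      (|deriv φ (A x l)| * |θ l|) ^ 2 * A h l ^ 2 := by
        rw [mul_pow |deriv φ (A x l)|, sq_abs, sq_abs]; ring
    rw [h1]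
    gcongr
    exacts [hφM _, ht l]
  rw [Real.norm_eq_abs, abs_mul, abs_two]
  calc 2 * |inner ℝ (A u) m'| ≤ 2 * (‖A u‖ * ‖m'‖) := by
        gcongr; exact abs_real_inner_le_norm _ _
    _ ≤ 2 * ((B * (B * C₀)) * (M * t * (B * ‖h‖))) := by
        gcongr
        · exact (hAn u).trans (by gcongr)
        · exact hm'n.trans (by gcongr; exact hAn h)
    _ = _ := by ring

/-- The derivative is continuous, and vanishes off [0, 1] because the function is constant on each
side. -/
lemma exists_abs_deriv_smoothTransition_le :
    ∃ M : ℝ, 0 < M ∧ ∀ z, |deriv Real.smoothTransition z| ≤ M := by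
  have hc : Continuous (deriv Real.smoothTransition) :=
    (Real.smoothTransition.contDiff (n := 1)).continuous_deriv (by norm_num)
  obtain ⟨M, hM⟩ := isCompact_Icc.exists_bound_of_continuousOn (s := Set.Icc (0 : ℝ) 1)
    hc.continuousOn
  refine ⟨max M 1, by positivity, fun z => ?_⟩
  by_cases hz : z ∈ Set.Icc (0 : ℝ) 1
  · exact (hM z hz).trans (le_max_left _ _)
  · have : deriv Real.smoothTransition z = 0 := by
      rw [Set.mem_Icc, not_and_or, not_le, not_le] at hz
      rcases hz with hz | hz
      · have : Real.smoothTransition =ᶠ[𝓝 z] fun _ => 0 := by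
          filter_upwards [Iio_mem_nhds hz] with y hy
          exact Real.smoothTransition.zero_of_nonpos hy.le
        rw [this.deriv_eq, deriv_const]
      · have : Real.smoothTransition =ᶠ[𝓝 z] fun _ => 1 := by
          filter_upwards [Ioi_mem_nhds hz] with y hy
          exact Real.smoothTransition.one_of_one_le hy.le
        rw [this.deriv_eq, deriv_const]
    rw [this, abs_zero]; positivity

/-- The smooth surrogate of the indicator of `(0, ∞)`, exact outside `(0, τ)`. -/
noncomputable def softStep (τ z : ℝ) : ℝ := Real.smoothTransition (z / τ)

lemma contDiff_softStep (τ : ℝ) : ContDiff ℝ 1 (softStep τ) :=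
  (Real.smoothTransition.contDiff (n := 1)).comp (contDiff_id.div_const τ)

lemma softStep_nonneg (τ z : ℝ) : 0 ≤ softStep τ z := Real.smoothTransition.nonneg _

lemma softStep_le_one (τ z : ℝ) : softStep τ z ≤ 1 := Real.smoothTransition.le_one _

lemma abs_softStep_le_one (τ z : ℝ) : |softStep τ z| ≤ 1 := by
  rw [abs_of_nonneg (softStep_nonneg τ z)]; exact softStep_le_one τ z

lemma abs_deriv_softStep_le {M τ : ℝ} (hM : ∀ z, |deriv Real.smoothTransition z| ≤ M)
    (hτ : 0 < τ) (z : ℝ) : |deriv (softStep τ) z| ≤ M / τ := by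
  have h1 : HasDerivAt Real.smoothTransition (deriv Real.smoothTransition (z / τ)) (z / τ) :=
    ((Real.smoothTransition.contDiff (n := 1)).differentiable
      (by norm_num)).differentiableAt.hasDerivAt
  have h2 : HasDerivAt (softStep τ) (deriv Real.smoothTransition (z / τ) * (1 / τ)) z :=
    h1.comp z ((hasDerivAt_id z).div_const τ)
  rw [h2.deriv, abs_mul, abs_of_pos (by positivity : 0 < 1 / τ), mul_one_div]
  gcongr
  exact hM _

lemma sq_step_sub_softStep_le {τ : ℝ} (hτ : 0 < τ) (z : ℝ) :
    ((if 0 < z then (1 : ℝ) else 0) - softStep τ z) ^ 2 ≤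
      (Set.Ioo 0 τ).indicator (fun _ => 1) z := by
  by_cases hz : z ∈ Set.Ioo 0 τ
  · rw [Set.indicator_of_mem hz, if_pos hz.1, sq_le_one_iff_abs_le_one, abs_le]
    constructor <;> linarith [softStep_nonneg τ z, softStep_le_one τ z]
  · rw [Set.indicator_of_notMem hz]
    rw [Set.mem_Ioo, not_and_or, not_lt, not_lt] at hz
    by_cases h0 : 0 < z
    · have h1 : τ ≤ z := hz.resolve_left (not_le.2 h0)
      rw [if_pos h0, softStep, Real.smoothTransition.one_of_one_le ((one_le_div hτ).2 h1)]
      simp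
    · rw [if_neg h0, softStep, Real.smoothTransition.zero_of_nonpos
        (div_nonpos_of_nonpos_of_nonneg (not_lt.1 h0) hτ.le)]
      simp

/-- The two masks differ only at those l with 0 < ⟨w_l, x⟩ < s², an event of probability at most s²,
so the masked difference v satisfies E‖v‖² ≤ s²‖θ‖². -/
lemma lintegral_enorm_eta_sq_sub_smooth_le (hrows : UnitRows W) (hB : opNorm W ≤ B)
    {θ : EuclideanSpace ℝ (Fin N)} (hθ : ‖θ‖ ≤ C₀) {s : ℝ} (hs : 0 < s) :
    ∫⁻ x, ‖eta W x θ ^ 2 - maskedSq W θ (fun l => softStep (s ^ 2) (rowMap W x l))‖ₑ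
      ∂(stdGaussian (EuclideanSpace ℝ (Fin d))) ≤
      ENNReal.ofReal (B ^ 2 * C₀ * (1 + C₀ ^ 2) * s) := by
  have hC : 0 ≤ C₀ := (norm_nonneg _).trans hθ
  have hB0 := opNorm_bound_nonneg hB
  set K := B ^ 2 * C₀ with hK
  have hK0 : 0 ≤ K := by positivity
  have hpt : ∀ x, ‖eta W x θ ^ 2 - maskedSq W θ (fun l => softStep (s ^ 2) (rowMap W x l))‖ₑ ≤
      ENNReal.ofReal (K * s) + ∑ l, ENNReal.ofReal (K / s * θ l ^ 2) *
        {x | inner ℝ (WithLp.toLp 2 (W l) : EuclideanSpace ℝ (Fin d)) x ∈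
          Set.Ioo 0 (s ^ 2)}.indicator 1 x := by
    intro x
    set v := mask θ (activation W x - fun l => softStep (s ^ 2) (rowMap W x l)) with hv
    have h1 : |eta W x θ ^ 2 - maskedSq W θ (fun l => softStep (s ^ 2) (rowMap W x l))| ≤
        2 * B ^ 2 * C₀ * ‖v‖ := by
      rw [eta_sq_eq_maskedSq]
      exact abs_maskedSq_sub_le hB hθ (abs_activation_le_one W x) fun l => abs_softStep_le_one _ _
    -- AM-GM trades ‖v‖ for ‖v‖², whose expectation is a sum over single rows; the weight s balances
    -- the two terms.
    have h2 : 2 * ‖v‖ ≤ s + ‖v‖ ^ 2 / s := by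
      have : s + ‖v‖ ^ 2 / s - 2 * ‖v‖ = (s - ‖v‖) ^ 2 / s := by field_simp; ring
      have h3 : 0 ≤ (s - ‖v‖) ^ 2 / s := by positivity
      linarith
    have h3 : ‖v‖ ^ 2 ≤ ∑ l, θ l ^ 2 * (Set.Ioo 0 (s ^ 2)).indicator (fun _ => 1)
        (inner ℝ (WithLp.toLp 2 (W l) : EuclideanSpace ℝ (Fin d)) x) := by
      rw [hv, norm_mask_sq]
      refine Finset.sum_le_sum fun l _ => ?_
      rw [mul_pow, mul_comm, ← rowMap_apply_eq_inner]
      exact mul_le_mul_of_nonneg_left (sq_step_sub_softStep_le (by positivity) _) (sq_nonneg _)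
    rw [← ofReal_norm, Real.norm_eq_abs]
    calc ENNReal.ofReal |eta W x θ ^ 2 - maskedSq W θ (fun l => softStep (s ^ 2) (rowMap W x l))|
        ≤ ENNReal.ofReal (K * s + ∑ l, K / s * θ l ^ 2 * (Set.Ioo 0 (s ^ 2)).indicator
          (fun _ => 1) (inner ℝ (WithLp.toLp 2 (W l) : EuclideanSpace ℝ (Fin d)) x)) := by
          refine ENNReal.ofReal_le_ofReal ?_
          calc _ ≤ 2 * B ^ 2 * C₀ * ‖v‖ := h1
            _ = K * (2 * ‖v‖) := by rw [hK]; ring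
            _ ≤ K * (s + ‖v‖ ^ 2 / s) := by gcongr
            _ = K * s + K / s * ‖v‖ ^ 2 := by ring
            _ ≤ K * s + K / s * ∑ l, θ l ^ 2 * (Set.Ioo 0 (s ^ 2)).indicator (fun _ => 1)
              (inner ℝ (WithLp.toLp 2 (W l) : EuclideanSpace ℝ (Fin d)) x) := by gcongr
            _ = _ := by rw [Finset.mul_sum]; simp only [mul_assoc]
      _ ≤ _ := by
          have hind : ∀ l, 0 ≤ (Set.Ioo 0 (s ^ 2)).indicator (fun _ => (1 : ℝ))
              (inner ℝ (WithLp.toLp 2 (W l) : EuclideanSpace ℝ (Fin d)) x) := fun l =>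
            Set.indicator_nonneg (fun _ _ => zero_le_one) _
          rw [ENNReal.ofReal_add (by positivity) (Finset.sum_nonneg fun l _ =>
            mul_nonneg (by positivity) (hind l)), ENNReal.ofReal_sum_of_nonneg fun l _ =>
            mul_nonneg (by positivity) (hind l)]
          gcongr with l
          rw [ENNReal.ofReal_mul (by positivity)]
          gcongr
          by_cases hx : inner ℝ (WithLp.toLp 2 (W l) : EuclideanSpace ℝ (Fin d)) x ∈
            Set.Ioo 0 (s ^ 2)
          · rw [Set.indicator_of_mem hx, Set.indicator_of_mem (by exact hx)]; simp
          · rw [Set.indicator_of_notMem hx]; simp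
  have hms : ∀ l, MeasurableSet {x : EuclideanSpace ℝ (Fin d) |
      inner ℝ (WithLp.toLp 2 (W l) : EuclideanSpace ℝ (Fin d)) x ∈ Set.Ioo 0 (s ^ 2)} := fun l =>
    (by fun_prop : Continuous fun x : EuclideanSpace ℝ (Fin d) =>
      inner ℝ (WithLp.toLp 2 (W l) : EuclideanSpace ℝ (Fin d)) x).measurable measurableSet_Ioo
  refine (lintegral_mono hpt).trans ?_
  rw [lintegral_add_left measurable_const, lintegral_const, measure_univ, mul_one,
    lintegral_finsetSum _ fun l _ => (measurable_one.indicator (hms l)).const_mul _]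
  calc _ ≤ ENNReal.ofReal (K * s) + ∑ l, ENNReal.ofReal (K / s * θ l ^ 2) *
          ENNReal.ofReal (s ^ 2) := by
        gcongr with l
        rw [lintegral_const_mul _ (measurable_one.indicator (hms l)),
          lintegral_indicator_one (hms l)]
        gcongr
        exact stdGaussian_inner_Ioo_le (hrows.norm_eq_one l) _
    _ = ENNReal.ofReal (K * s + K * s * ‖θ‖ ^ 2) := by
        rw [EuclideanSpace.real_norm_sq_eq, Finset.mul_sum,
          ENNReal.ofReal_add (by positivity) (by positivity),
          ENNReal.ofReal_sum_of_nonneg fun l _ => by positivity]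
        congr 1
        refine Finset.sum_congr rfl fun l _ => ?_
        rw [← ENNReal.ofReal_mul (by positivity)]
        congr 1
        field_simp
    _ ≤ _ := by
        refine ENNReal.ofReal_le_ofReal ?_
        have : ‖θ‖ ^ 2 ≤ C₀ ^ 2 := by gcongr
        nlinarith [mul_le_mul_of_nonneg_left this (mul_nonneg hK0 hs.le)]

end Smoothing

/-! ### Deviation of η(θ)² from its mean for one θ and one sample. -/

section Concentration

/-- Jensen's inequality in the second copy bounds the mean absolute deviation by D; Markov's
inequality concludes. -/
lemma measure_lt_abs_sub_integral_le {E : Type*} [MeasurableSpace E] {μ : Measure E}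
    [IsProbabilityMeasure μ] {g : E → ℝ} (hg : Measurable g) (hgi : Integrable g μ) {D γ : ℝ}
    (hD : ∫⁻ z, ‖g z.1 - g z.2‖ₑ ∂(μ.prod μ) ≤ ENNReal.ofReal D) (hγ : 0 < γ) :
    μ {x | γ < |g x - ∫ y, g y ∂μ|} ≤ ENNReal.ofReal (D / γ) := by
  have h1 : ∫⁻ x, ‖g x - ∫ y, g y ∂μ‖ₑ ∂μ ≤ ENNReal.ofReal D := by
    refine le_trans ?_ hD
    rw [lintegral_prod _ (by fun_prop)]
    refine lintegral_mono fun x => ?_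
    have : g x - ∫ y, g y ∂μ = ∫ y, (g x - g y) ∂μ := by
      rw [integral_sub (integrable_const _) hgi]; simp
    rw [this]
    exact enorm_integral_le_lintegral_enorm _
  have h2 := mul_meas_ge_le_lintegral (μ := μ) (f := fun x => ‖g x - ∫ y, g y ∂μ‖ₑ)
    (by fun_prop) (ENNReal.ofReal γ)
  rw [ENNReal.ofReal_div_of_pos hγ, ENNReal.le_div_iff_mul_le (by simp [hγ]) (by simp), mul_comm]
  refine le_trans ?_ (h2.trans h1)
  gcongr ENNReal.ofReal γ * μ ?_
  intro x hx
  simp only [Set.mem_ofPred_eq] at hx ⊢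
  rw [← ofReal_norm, Real.norm_eq_abs]
  exact ENNReal.ofReal_le_ofReal hx.le

variable {N d : ℕ} {W : Matrix (Fin N) (Fin d) ℝ} {B C₀ : ℝ}

lemma integrable_eta_sq (W : Matrix (Fin N) (Fin d) ℝ) (θ : EuclideanSpace ℝ (Fin N))
    (μ : Measure (EuclideanSpace ℝ (Fin d))) [IsProbabilityMeasure μ] :
    Integrable (fun x => eta W x θ ^ 2) μ := by
  refine Integrable.of_bound (measurable_eta_sq W θ).aestronglyMeasurable
    ((opNorm W * ‖θ‖) ^ 2) (.of_forall fun x => ?_)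
  rw [Real.norm_of_nonneg (sq_nonneg _)]
  exact eta_sq_le le_rfl le_rfl x

/-- The first term is the Poincaré bound for the smooth surrogate at width s², the second is the
smoothing error paid once for each of the two copies. -/
lemma stdGaussian_eta_sq_deviation_le {M : ℝ} (hM : ∀ z, |deriv Real.smoothTransition z| ≤ M)
    (hrows : UnitRows W) (hB : opNorm W ≤ B)
    {θ : EuclideanSpace ℝ (Fin N)} (hθ : ‖θ‖ ≤ C₀) {t : ℝ} (ht : ∀ l, |θ l| ≤ t) (ht0 : 0 ≤ t)
    {s γ : ℝ} (hs : 0 < s) (hγ : 0 < γ) :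
    stdGaussian (EuclideanSpace ℝ (Fin d))
      {x | γ < |eta W x θ ^ 2 - ∫ y, eta W y θ ^ 2 ∂(stdGaussian (EuclideanSpace ℝ (Fin d)))|} ≤
    ENNReal.ofReal ((4 * B ^ 3 * C₀ * M * t / s ^ 2 + 2 * B ^ 2 * C₀ * (1 + C₀ ^ 2) * s) / γ) := by
  have hC : 0 ≤ C₀ := (norm_nonneg _).trans hθ
  have hB0 := opNorm_bound_nonneg hB
  have hM0 : 0 ≤ M := (abs_nonneg _).trans (hM 0)
  refine measure_lt_abs_sub_integral_le (measurable_eta_sq W θ) (integrable_eta_sq W θ _) ?_ hγ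
  set μ := stdGaussian (EuclideanSpace ℝ (Fin d))
  set f : EuclideanSpace ℝ (Fin d) → ℝ :=
    fun x => maskedSq W θ fun l => softStep (s ^ 2) (rowMap W x l) with hf
  set g : EuclideanSpace ℝ (Fin d) → ℝ := fun x => eta W x θ ^ 2 with hg
  have hgm : Measurable g := measurable_eta_sq W θ
  have hfc : ContDiff ℝ 1 f := contDiff_maskedSq_comp W θ (contDiff_softStep _)
  have hfm : Measurable f := hfc.continuous.measurable
  have h1 := lintegral_enorm_sub_stdGaussian_le hfc (norm_fderiv_maskedSq_comp_le hB hθ ht ht0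
    (contDiff_softStep (s ^ 2)) (abs_softStep_le_one _) (abs_deriv_softStep_le hM (by positivity)))
  have h2 : ∫⁻ x, ‖g x - f x‖ₑ ∂μ ≤ ENNReal.ofReal (B ^ 2 * C₀ * (1 + C₀ ^ 2) * s) :=
    lintegral_enorm_eta_sq_sub_smooth_le hrows hB hθ hs
  have hfst : ∫⁻ z, ‖g z.1 - f z.1‖ₑ ∂(μ.prod μ) = ∫⁻ x, ‖g x - f x‖ₑ ∂μ :=
    measurePreserving_fst.lintegral_comp (f := fun x => ‖g x - f x‖ₑ) (by fun_prop)
  have hsnd : ∫⁻ z, ‖g z.2 - f z.2‖ₑ ∂(μ.prod μ) = ∫⁻ x, ‖g x - f x‖ₑ ∂μ :=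
    measurePreserving_snd.lintegral_comp (f := fun x => ‖g x - f x‖ₑ) (by fun_prop)
  calc ∫⁻ z, ‖g z.1 - g z.2‖ₑ ∂(μ.prod μ)
      ≤ ∫⁻ z, (‖f z.1 - f z.2‖ₑ + ‖g z.1 - f z.1‖ₑ + ‖g z.2 - f z.2‖ₑ) ∂(μ.prod μ) := by
        refine lintegral_mono fun z => ?_
        have : g z.1 - g z.2 = (f z.1 - f z.2) + (g z.1 - f z.1) - (g z.2 - f z.2) := by ring
        rw [this]
        exact enorm_sub_le.trans (by gcongr; exact enorm_add_le _ _)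
    _ = ∫⁻ z, ‖f z.1 - f z.2‖ₑ ∂(μ.prod μ) + ∫⁻ x, ‖g x - f x‖ₑ ∂μ
          + ∫⁻ x, ‖g x - f x‖ₑ ∂μ := by
        rw [lintegral_add_right _ (by fun_prop), lintegral_add_right _ (by fun_prop), hfst, hsnd]
    _ ≤ ENNReal.ofReal (Real.pi / 2 * (2 * B ^ 3 * C₀ * (M / s ^ 2) * t)) +
        ENNReal.ofReal (B ^ 2 * C₀ * (1 + C₀ ^ 2) * s) +
        ENNReal.ofReal (B ^ 2 * C₀ * (1 + C₀ ^ 2) * s) := by gcongr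
    _ ≤ _ := by
        rw [← ENNReal.ofReal_add (by positivity) (by positivity),
          ← ENNReal.ofReal_add (by positivity) (by positivity)]
        refine ENNReal.ofReal_le_ofReal ?_
        have : Real.pi / 2 * (2 * B ^ 3 * C₀ * (M / s ^ 2) * t) ≤
            2 * (2 * B ^ 3 * C₀ * (M / s ^ 2) * t) := by
          gcongr
          linarith [Real.pi_le_four]
        calc _ ≤ 2 * (2 * B ^ 3 * C₀ * (M / s ^ 2) * t) + B ^ 2 * C₀ * (1 + C₀ ^ 2) * s
              + B ^ 2 * C₀ * (1 + C₀ ^ 2) * s := by gcongr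
          _ = _ := by ring

end Concentration

/-! ### Finite nets from a volume bound. -/

section Net

variable {E : Type*} [NormedAddCommGroup E] [NormedSpace ℝ E] [FiniteDimensional ℝ E]

/-- Balls of radius ε/2 about the points are disjoint and lie in the ball of radius R + ε/2; compare
volumes. -/
lemma card_le_of_separated {s : Finset E} {R ε : ℝ} (hε : 0 < ε) (hR : 0 ≤ R)
    (hs : ∀ c ∈ s, ‖c‖ ≤ R) (h : ∀ c ∈ s, ∀ e ∈ s, c ≠ e → ε ≤ ‖c - e‖) :
    (s.card : ℝ) ≤ (1 + 2 * R / ε) ^ Module.finrank ℝ E := by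
  borelize E
  let μ : Measure E := Measure.addHaar
  set A := ⋃ c ∈ s, Metric.ball (c : E) (ε / 2) with hA
  have D : Set.Pairwise (s : Set E)
      (Function.onFun Disjoint fun c => Metric.ball (c : E) (ε / 2)) := by
    intro c hc e he hce
    refine Metric.ball_disjoint_ball ?_
    rw [dist_eq_norm, add_halves]
    exact h c hc e he hce
  have A_subset : A ⊆ Metric.ball (0 : E) (ε / 2 + R) := by
    refine Set.iUnion₂_subset fun x hx => Metric.ball_subset_ball' ?_
    rw [dist_zero_right]
    exact add_le_add le_rfl (hs x hx)
  have I : (s.card : ENNReal) * ENNReal.ofReal ((ε / 2) ^ Module.finrank ℝ E) *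
      μ (Metric.ball 0 1) ≤
      ENNReal.ofReal ((ε / 2 + R) ^ Module.finrank ℝ E) * μ (Metric.ball 0 1) :=
    calc _ = μ A := by
          rw [hA, measure_biUnion_finset D fun c _ => measurableSet_ball]
          simp only [μ.addHaar_ball_of_pos _ (half_pos hε)]
          simp only [Finset.sum_const, nsmul_eq_mul, mul_assoc]
      _ ≤ μ (Metric.ball (0 : E) (ε / 2 + R)) := measure_mono A_subset
      _ = _ := by rw [μ.addHaar_ball_of_pos _ (by positivity)]
  have J := (ENNReal.mul_le_mul_iff_left (Metric.measure_ball_pos _ _ zero_lt_one).ne'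
    measure_ball_lt_top.ne).1 I
  have K : (s.card : ℝ) * (ε / 2) ^ Module.finrank ℝ E ≤ (ε / 2 + R) ^ Module.finrank ℝ E := by
    have := ENNReal.toReal_le_of_le_ofReal (by positivity) J
    rwa [ENNReal.toReal_mul, ENNReal.toReal_natCast,
      ENNReal.toReal_ofReal (by positivity)] at this
  have e : 1 + 2 * R / ε = (ε / 2 + R) / (ε / 2) := by field_simp
  rw [e, div_pow, le_div_iff₀ (by positivity)]
  exact K

/-- A separated subset of maximal cardinality is a net. Its points are kept in A so that the
sup-norm constraint holds at the centres. -/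
lemma exists_finset_net {A : Set E} {R ε : ℝ} (hε : 0 < ε) (hR : 0 ≤ R) (hA : ∀ a ∈ A, ‖a‖ ≤ R) :
    ∃ s : Finset E, (∀ c ∈ s, c ∈ A) ∧ (s.card : ℝ) ≤ (1 + 2 * R / ε) ^ Module.finrank ℝ E ∧
      ∀ a ∈ A, ∃ c ∈ s, ‖a - c‖ ≤ ε := by
  classical
  let T : Set ℕ := {k | ∃ s : Finset E, (∀ c ∈ s, c ∈ A) ∧
    (∀ c ∈ s, ∀ e ∈ s, c ≠ e → ε ≤ ‖c - e‖) ∧ s.card = k}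
  have hbdd : BddAbove T := by
    refine ⟨⌊(1 + 2 * R / ε) ^ Module.finrank ℝ E⌋₊, ?_⟩
    rintro _ ⟨s, hsA, hsep, rfl⟩
    exact Nat.le_floor (card_le_of_separated hε hR (fun c hc => hA c (hsA c hc)) hsep)
  have hne : T.Nonempty := ⟨0, ∅, by simp, by simp, rfl⟩
  obtain ⟨s, hsA, hsep, hcard⟩ := Nat.sSup_mem hne hbdd
  refine ⟨s, hsA, card_le_of_separated hε hR (fun c hc => hA c (hsA c hc)) hsep,
    fun a ha => ?_⟩
  by_contra! hfar
  have hnot : a ∉ s := fun has => by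
    have := hfar a has
    simp only [sub_self, norm_zero] at this
    exact absurd this (not_lt.2 hε.le)
  have hmem : (insert a s).card ∈ T := by
    refine ⟨insert a s, ?_, ?_, rfl⟩
    · simpa using ⟨ha, hsA⟩
    · intro c hc e he hce
      rcases Finset.mem_insert.1 hc with rfl | hc' <;> rcases Finset.mem_insert.1 he with rfl | he'
      · exact absurd rfl hce
      · exact (hfar e he').le
      · rw [norm_sub_rev]; exact (hfar c hc').le
      · exact hsep c hc' e he' hce
  have := le_csSup hbdd hmem
  rw [Finset.card_insert_of_notMem hnot, hcard] at this
  omega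

end Net

/-! ### A Chernoff bound for the number of bad samples. -/

section Chernoff

lemma measure_le_sum_indicator_le {Ω E : Type*} [MeasurableSpace Ω] [MeasurableSpace E]
    {P : Measure Ω} [IsProbabilityMeasure P] {μ : Measure E} {n : ℕ} {X : Fin n → Ω → E}
    (hX : ∀ i, HasLaw (X i) μ P) (hindep : iIndepFun X P) {S : Set E} (hS : MeasurableSet S)
    {p : ℝ} (hp0 : 0 < p) (hp1 : p ≤ 1) (hp : μ S ≤ ENNReal.ofReal p) (a : ℝ) :
    P {ω | a ≤ ∑ i, S.indicator (fun _ => (1 : ℝ)) (X i ω)} ≤ ENNReal.ofReal (2 ^ n * p ^ a) := by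
  set Y : Fin n → Ω → ℝ := fun i ω => S.indicator (fun _ => (1 : ℝ)) (X i ω) with hY
  have hSm : Measurable (S.indicator fun _ => (1 : ℝ)) := measurable_const.indicator hS
  have hYm : ∀ i, AEMeasurable (Y i) P := fun i => hSm.comp_aemeasurable (hX i).aemeasurable
  have hYi : iIndepFun Y P := hindep.comp (fun _ => S.indicator fun _ => (1 : ℝ)) fun _ => hSm
  have hY01 : ∀ i ω, Y i ω = 0 ∨ Y i ω = 1 := fun i ω => by
    by_cases h : X i ω ∈ S
    · right; simp [hY, h]
    · left; simp [hY, h]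
  -- This choice gives E e^{tY} ≤ 1 + (p⁻¹ - 1)p ≤ 2 per sample, while the prefactor e^{-ta} is
  -- exactly p^a.
  set t := -Real.log p with ht
  have ht0 : 0 ≤ t := neg_nonneg.2 (Real.log_nonpos hp0.le hp1)
  have hexp : Real.exp t = p⁻¹ := by rw [ht, Real.exp_neg, Real.exp_log hp0]
  have hmgf : ∀ i, mgf (Y i) P t ≤ 2 := by
    intro i
    have hfun : (fun ω => Real.exp (t * Y i ω)) = fun ω => 1 + (p⁻¹ - 1) * Y i ω := by
      ext ω
      rcases hY01 i ω with h | h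
      · simp [h]
      · simp [h, hexp]
    have hYint : Integrable (Y i) P := Integrable.of_bound (hYm i).aestronglyMeasurable 1
      (.of_forall fun ω => by rcases hY01 i ω with h | h <;> simp [h])
    have hEY : ∫ ω, Y i ω ∂P ≤ p := by
      have h1 : ∫ ω, Y i ω ∂P = ∫ x, S.indicator (fun _ => (1 : ℝ)) x ∂μ :=
        (hX i).integral_comp hSm.aestronglyMeasurable
      rw [h1, integral_indicator hS]
      simp only [integral_const, smul_eq_mul, mul_one, measureReal_restrict_apply_univ]
      exact ENNReal.toReal_le_of_le_ofReal hp0.le hp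
    rw [mgf, hfun, integral_add (integrable_const _) (hYint.const_mul _), integral_const_mul]
    have h1 : 0 ≤ p⁻¹ - 1 := sub_nonneg.2 ((one_le_inv₀ hp0).2 hp1)
    have h2 : (p⁻¹ - 1) * ∫ ω, Y i ω ∂P ≤ (p⁻¹ - 1) * p := mul_le_mul_of_nonneg_left hEY h1
    have h3 : (p⁻¹ - 1) * p = 1 - p := by field_simp
    simp only [integral_const, probReal_univ, smul_eq_mul, mul_one]
    linarith
  have hsum_int : Integrable (fun ω => Real.exp (t * (∑ i, Y i) ω)) P := by
    refine Integrable.of_bound (C := Real.exp (t * n)) ?_ (.of_forall fun ω => ?_)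
    · have : AEMeasurable (∑ i, Y i) P := Finset.aemeasurable_sum _ fun i _ => hYm i
      exact (Real.measurable_exp.comp_aemeasurable (this.const_mul t)).aestronglyMeasurable
    · rw [Real.norm_of_nonneg (Real.exp_pos _).le, Finset.sum_apply]
      refine Real.exp_le_exp.2 (mul_le_mul_of_nonneg_left ?_ ht0)
      calc ∑ i, Y i ω ≤ ∑ _i : Fin n, (1 : ℝ) := Finset.sum_le_sum fun i _ => by
            rcases hY01 i ω with h | h <;> simp [h]
        _ = n := by simp
  have hch := measure_ge_le_exp_mul_mgf (μ := P) (X := ∑ i, Y i) a ht0 hsum_int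
  rw [hYi.mgf_sum₀ hYm] at hch
  have hprod : ∏ i, mgf (Y i) P t ≤ 2 ^ n := by
    calc ∏ i, mgf (Y i) P t ≤ ∏ _i : Fin n, (2 : ℝ) :=
          Finset.prod_le_prod (fun i _ => mgf_nonneg) fun i _ => hmgf i
      _ = 2 ^ n := by simp
  have hpa : Real.exp (-t * a) = p ^ a := by
    rw [ht, neg_neg, Real.rpow_def_of_pos hp0]
  rw [hpa] at hch
  have hfin := hch.trans (mul_le_mul_of_nonneg_left hprod (Real.rpow_nonneg hp0.le a))
  rw [mul_comm] at hfin
  simp only [Finset.sum_apply] at hfin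
  rw [← ENNReal.ofReal_toReal (measure_ne_top P _)]
  exact ENNReal.ofReal_le_ofReal hfin

end Chernoff

/-! ### Union bound over the net. -/

section Supremum

variable {N d n : ℕ} {Ω : Type*} [MeasurableSpace Ω] {P : Measure Ω}
  {W : Matrix (Fin N) (Fin d) ℝ} {B C₀ : ℝ} {X : Fin n → Ω → EuclideanSpace ℝ (Fin d)}

/-- The set of points at which `η(θ)²` is more than `γ` away from its Gaussian mean. -/
def deviationSet (W : Matrix (Fin N) (Fin d) ℝ) (θ : EuclideanSpace ℝ (Fin N)) (γ : ℝ) :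
    Set (EuclideanSpace ℝ (Fin d)) :=
  {x | γ < |eta W x θ ^ 2 - ∫ y, eta W y θ ^ 2 ∂(stdGaussian (EuclideanSpace ℝ (Fin d)))|}

lemma measurableSet_deviationSet (W : Matrix (Fin N) (Fin d) ℝ)
    (θ : EuclideanSpace ℝ (Fin N)) (γ : ℝ) : MeasurableSet (deviationSet W θ γ) :=
  measurableSet_lt measurable_const ((measurable_eta_sq W θ).sub measurable_const).abs

lemma nu_eq_indicator {x : Ω → EuclideanSpace ℝ (Fin d)}
    (hx : HasLaw x (stdGaussian (EuclideanSpace ℝ (Fin d))) P)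
    (θ : EuclideanSpace ℝ (Fin N)) (γ : ℝ) (ω : Ω) :
    nu P W x θ γ ω = (deviationSet W θ γ).indicator (fun _ => 1) (x ω) := by
  have h : ∫ ω', eta W (x ω') θ ^ 2 ∂P =
      ∫ y, eta W y θ ^ 2 ∂(stdGaussian (EuclideanSpace ℝ (Fin d))) :=
    hx.integral_comp (measurable_eta_sq W θ).aestronglyMeasurable
  classical
  rw [nu, h, Set.indicator_apply]
  exact if_congr Iff.rfl rfl rfl

/-- The value and the mean each move by at most γ/4, which costs half of the threshold. -/
lemma deviationSet_subset (hB : opNorm W ≤ B) {θ θ' : EuclideanSpace ℝ (Fin N)}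
    (hθ : ‖θ‖ ≤ C₀) (hθ' : ‖θ'‖ ≤ C₀) {γ ε : ℝ} (hε : ‖θ - θ'‖ ≤ ε)
    (hεγ : 8 * B ^ 2 * C₀ * ε ≤ γ) : deviationSet W θ γ ⊆ deviationSet W θ' (γ / 2) := by
  intro x hx
  have hC : 0 ≤ C₀ := (norm_nonneg _).trans hθ
  set μ := stdGaussian (EuclideanSpace ℝ (Fin d))
  have hpt : ∀ y, |eta W y θ ^ 2 - eta W y θ' ^ 2| ≤ γ / 4 := fun y =>
    (abs_eta_sq_sub_le hB hθ hθ' y).trans (by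
      have : 2 * B ^ 2 * C₀ * ‖θ - θ'‖ ≤ 2 * B ^ 2 * C₀ * ε := by gcongr
      linarith)
  have hint : |∫ y, eta W y θ ^ 2 ∂μ - ∫ y, eta W y θ' ^ 2 ∂μ| ≤ γ / 4 := by
    rw [← integral_sub (integrable_eta_sq W θ μ) (integrable_eta_sq W θ' μ)]
    have := norm_integral_le_of_norm_le_const (μ := μ) (C := γ / 4)
      (f := fun y => eta W y θ ^ 2 - eta W y θ' ^ 2) (.of_forall hpt)
    simpa using this
  have hx' : γ < |eta W x θ ^ 2 - ∫ y, eta W y θ ^ 2 ∂μ| := hx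
  change γ / 2 < |eta W x θ' ^ 2 - ∫ y, eta W y θ' ^ 2 ∂μ|
  have h1 := hpt x
  rw [abs_le] at h1 hint
  rw [lt_abs] at hx' ⊢
  rcases hx' with h | h
  · left; linarith [h1.2, hint.1]
  · right; linarith [h1.1, hint.2]

lemma supFraction_nonneg (γ : ℝ) (ω : Ω) : 0 ≤ supFraction P W X C₀ γ ω := by
  refine Real.iSup_nonneg fun θ => mul_nonneg (by positivity) (Finset.sum_nonneg fun i _ => ?_)
  unfold nu; split_ifs <;> norm_num

lemma measure_lt_supFraction_le [IsProbabilityMeasure P]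
    (hX : ∀ i, HasLaw (X i) (stdGaussian (EuclideanSpace ℝ (Fin d))) P) (hindep : iIndepFun X P)
    (hrows : UnitRows W) (hB : opNorm W ≤ B) (hC₀ : 0 ≤ C₀) {M : ℝ}
    (hM : ∀ z, |deriv Real.smoothTransition z| ≤ M) {s γ ε p δ : ℝ} (hs : 0 < s) (hγ : 0 < γ)
    (hε : 0 < ε) (hεγ : 8 * B ^ 2 * C₀ * ε ≤ γ) (hp0 : 0 < p) (hp1 : p ≤ 1)
    (hp : (4 * B ^ 3 * C₀ * M * (C₀ * √(Real.log d / d)) / s ^ 2 +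
      2 * B ^ 2 * C₀ * (1 + C₀ ^ 2) * s) / (γ / 2) ≤ p) (hδ : 0 ≤ δ) :
    P {ω | δ < supFraction P W X C₀ γ ω} ≤
      ENNReal.ofReal ((1 + 2 * C₀ / ε) ^ N * (2 ^ n * p ^ (δ * n))) := by
  obtain ⟨net, hnetA, hcard, hnet⟩ := exists_finset_net (A := paramSet N d C₀) hε hC₀
    fun a ha => ha.2
  rw [finrank_euclideanSpace_fin] at hcard
  have hsub : {ω | δ < supFraction P W X C₀ γ ω} ⊆ ⋃ θ ∈ net,
      {ω | δ * n ≤ ∑ i, (deviationSet W θ (γ / 2)).indicator (fun _ => (1 : ℝ)) (X i ω)} := by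
    intro ω hω
    by_contra hcon
    simp only [Set.mem_iUnion, Set.mem_ofPred_eq, not_exists, not_le] at hcon
    refine absurd hω (not_lt.2 (Real.iSup_le (fun θ => ?_) hδ))
    obtain ⟨θ', hθ', hdist⟩ := hnet θ.1 θ.2
    have hle : ∑ i, nu P W (X i) θ γ ω ≤
        ∑ i, (deviationSet W θ' (γ / 2)).indicator (fun _ => (1 : ℝ)) (X i ω) := by
      refine Finset.sum_le_sum fun i _ => ?_
      rw [nu_eq_indicator (hX i)]
      exact Set.indicator_le_indicator_of_subset
        (deviationSet_subset hB θ.2.2 (hnetA θ' hθ').2 hdist hεγ) (fun _ => zero_le_one) _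
    have hlt := hle.trans (hcon θ' hθ').le
    rcases Nat.eq_zero_or_pos n with hn | hn
    · subst hn; simpa using hδ
    · have hn' : (0 : ℝ) < n := by exact_mod_cast hn
      rw [one_div, inv_mul_le_iff₀ hn', mul_comm]
      exact hlt
  have hone : ∀ θ ∈ net, P {ω | δ * n ≤
      ∑ i, (deviationSet W θ (γ / 2)).indicator (fun _ => (1 : ℝ)) (X i ω)} ≤
      ENNReal.ofReal (2 ^ n * p ^ (δ * n)) := fun θ hθ =>
    measure_le_sum_indicator_le hX hindep (measurableSet_deviationSet W θ _) hp0 hp1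
      ((stdGaussian_eta_sq_deviation_le hM hrows hB (hnetA θ hθ).2 (hnetA θ hθ).1 (by positivity)
        hs (half_pos hγ)).trans (ENNReal.ofReal_le_ofReal hp)) _
  calc _ ≤ P (⋃ θ ∈ net, {ω | δ * n ≤
        ∑ i, (deviationSet W θ (γ / 2)).indicator (fun _ => (1 : ℝ)) (X i ω)}) := measure_mono hsub
    _ ≤ ∑ θ ∈ net, P {ω | δ * n ≤
        ∑ i, (deviationSet W θ (γ / 2)).indicator (fun _ => (1 : ℝ)) (X i ω)} :=
      measure_biUnion_finset_le _ _
    _ ≤ ∑ _θ ∈ net, ENNReal.ofReal (2 ^ n * p ^ (δ * n)) := Finset.sum_le_sum hone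
    _ = ENNReal.ofReal (net.card * (2 ^ n * p ^ (δ * n))) := by
      rw [Finset.sum_const, nsmul_eq_mul, ENNReal.ofReal_mul (Nat.cast_nonneg _),
        ENNReal.ofReal_natCast]
    _ ≤ _ := by gcongr

end Supremum

/-! ### Choice of scales in q = √(log d), and the limits. -/

section Asymptotics

lemma tendsto_sqrt_log_natCast_atTop : Tendsto (fun d : ℕ => √(Real.log d)) atTop atTop :=
  Real.tendsto_sqrt_atTop.comp (Real.tendsto_log_atTop.comp tendsto_natCast_atTop_atTop)

lemma sqrt_log_div_eq {d q : ℝ} (hd : 0 < d) (hq : 0 ≤ q) (h : Real.log d = q ^ 2) :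
    √(Real.log d / d) = q * Real.exp (-(q ^ 2 / 2)) := by
  have h1 : d = Real.exp (q ^ 2 / 2) ^ 2 := by
    rw [← Real.exp_nat_mul, ← Real.exp_log hd, h]; congr 1; push_cast; ring
  rw [Real.sqrt_eq_iff_eq_sq (by rw [h]; positivity) (by positivity), h, mul_pow]
  conv_lhs => rw [h1]
  rw [Real.exp_neg, inv_pow]
  rfl

lemma deviation_bound_le {q a b γ : ℝ} (hq : 48 ≤ q) (ha : 0 ≤ a) (hb : 0 ≤ b)
    (hab : 2 * (a + b) ≤ Real.exp q) (hγ : Real.exp (-q) ≤ γ) :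
    (a * (q * Real.exp (-(q ^ 2 / 2))) / Real.exp (-(q ^ 2 / 8)) ^ 2 +
      b * Real.exp (-(q ^ 2 / 8))) / (γ / 2) ≤ Real.exp (-(q ^ 2 / 16)) := by
  have hγ0 : 0 < γ := (Real.exp_pos _).trans_le hγ
  have hqe : q ≤ Real.exp q := by linarith [Real.add_one_le_exp q]
  have h1 : a * (q * Real.exp (-(q ^ 2 / 2))) / Real.exp (-(q ^ 2 / 8)) ^ 2 ≤
      a * Real.exp q * Real.exp (-(q ^ 2 / 8)) := by
    rw [← Real.exp_nat_mul, div_le_iff₀ (Real.exp_pos _), mul_assoc, mul_assoc,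
      ← Real.exp_add]
    gcongr
    push_cast
    nlinarith
  have h2 : b * Real.exp (-(q ^ 2 / 8)) ≤ b * Real.exp q * Real.exp (-(q ^ 2 / 8)) := by
    gcongr
    exact le_mul_of_one_le_right hb (Real.one_le_exp (by linarith))
  rw [div_le_iff₀ (half_pos hγ0)]
  calc _ ≤ a * Real.exp q * Real.exp (-(q ^ 2 / 8)) + b * Real.exp q * Real.exp (-(q ^ 2 / 8)) :=
        add_le_add h1 h2
    _ = 2 * (a + b) * (Real.exp q * Real.exp (-(q ^ 2 / 8))) / 2 := by ring
    _ ≤ Real.exp q * (Real.exp q * Real.exp (-(q ^ 2 / 8))) / 2 := by gcongr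
    _ = Real.exp (q + (q + -(q ^ 2 / 8))) / 2 := by rw [Real.exp_add, Real.exp_add]
    _ ≤ Real.exp (-(q ^ 2 / 16) + -q) / 2 := by
        refine div_le_div_of_nonneg_right (Real.exp_le_exp.2 ?_) zero_le_two
        -- The exponents compare once 3q ≤ q²/16, that is q ≥ 48.
        nlinarith
    _ = Real.exp (-(q ^ 2 / 16)) * Real.exp (-q) / 2 := by rw [Real.exp_add]
    _ ≤ Real.exp (-(q ^ 2 / 16)) * (γ / 2) := by
        rw [mul_div_assoc]
        gcongr

/-- K is chosen so that (ψ₂/2) d · Kq/16 = qd(2(ψ₁ + 1) + 2). The first summand cancels the net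
entropy 2qN; the surplus 2qd absorbs the cost of 2^n, since ψ₂/2 ≤ q, and still leaves at least q.
-/
lemma union_bound_le {N n : ℕ} {d q b ψ₁ ψ₂ K : ℝ} (hd : 1 ≤ d) (hq : 0 < q)
    (hb0 : 0 ≤ b) (hb : 1 + b ≤ Real.exp q) (hψ₂ : 0 < ψ₂)
    (hN : N ≤ (ψ₁ + 1) * d) (hn : ψ₂ / 2 * d ≤ n) (hK : K = 32 * (2 * (ψ₁ + 1) + 2) / ψ₂)
    (hKq : 16 ≤ K * q) (hqψ : ψ₂ / 2 ≤ q) :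
    (1 + b * Real.exp q) ^ N * (2 ^ n * Real.exp (-(q ^ 2 / 16)) ^ (K / q * n)) ≤
      Real.exp (-q) := by
  have h1 : 1 + b * Real.exp q ≤ Real.exp (2 * q) := by
    have : 1 ≤ Real.exp q := Real.one_le_exp hq.le
    calc 1 + b * Real.exp q ≤ (1 + b) * Real.exp q := by nlinarith
      _ ≤ Real.exp q * Real.exp q := by gcongr
      _ = Real.exp (2 * q) := by rw [← Real.exp_add, two_mul]
  have h2 : (2 : ℝ) ≤ Real.exp 1 := by linarith [Real.add_one_le_exp (1 : ℝ)]
  have h3 : (1 + b * Real.exp q) ^ N ≤ Real.exp (N * (2 * q)) := by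
    rw [Real.exp_nat_mul]; gcongr
  have h4 : (2 : ℝ) ^ n ≤ Real.exp (n * 1) := by
    rw [Real.exp_nat_mul]; gcongr
  have h5 : Real.exp (-(q ^ 2 / 16)) ^ (K / q * n) = Real.exp (-(K * q / 16 * n)) := by
    rw [← Real.exp_mul]; congr 1; field_simp
  rw [h5]
  calc _ ≤ Real.exp (N * (2 * q)) * (Real.exp (n * 1) * Real.exp (-(K * q / 16 * n))) := by gcongr
    _ = Real.exp (N * (2 * q) - n * (K * q / 16 - 1)) := by
        rw [← Real.exp_add, ← Real.exp_add]; congr 1; ring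
    _ ≤ Real.exp (-q) := by
        refine Real.exp_le_exp.2 ?_
        have e1 : N * (2 * q) ≤ (ψ₁ + 1) * d * (2 * q) := by gcongr
        have e2 : ψ₂ / 2 * d * (K * q / 16 - 1) ≤ n * (K * q / 16 - 1) :=
          mul_le_mul_of_nonneg_right hn (by linarith)
        have e3 : ψ₂ / 2 * d * (K * q / 16 - 1) =
            d * (2 * q * (ψ₁ + 1) + 2 * q - ψ₂ / 2) := by
          rw [hK]; field_simp; ring
        have e4 : q * 1 ≤ d * (2 * q - ψ₂ / 2) := by
          calc q * 1 ≤ (2 * q - ψ₂ / 2) * d := by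
                apply mul_le_mul _ hd zero_le_one <;> linarith
            _ = _ := mul_comm _ _
        nlinarith

variable {N n : ℕ → ℕ} {ψ₁ ψ₂ C C₀ : ℝ} {W : ∀ d, Matrix (Fin (N d)) (Fin d) ℝ}
  {Ω : ℕ → Type*} [∀ d, MeasurableSpace (Ω d)] {P : ∀ d, Measure (Ω d)}
  [∀ d, IsProbabilityMeasure (P d)] {X : ∀ d, Fin (n d) → Ω d → EuclideanSpace ℝ (Fin d)}

/-- Common source of both parts: of γ it needs only the lower bound e^{-q}, which keeps the net
scale at order e^{-q} and its entropy at order qd. -/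
theorem exists_tendsto_measure_lt_supFraction (hψ₁ : 0 < ψ₁) (hψ₂ : 0 < ψ₂)
    (hN : Tendsto (fun d : ℕ => (N d : ℝ) / d) atTop (𝓝 ψ₁))
    (hn : Tendsto (fun d : ℕ => (n d : ℝ) / d) atTop (𝓝 ψ₂)) (hC₀ : 0 < C₀)
    (hrows : ∀ᶠ d in atTop, UnitRows (W d)) (hW : ∀ᶠ d in atTop, EventW C (W d))
    (hX : ∀ d i, HasLaw (X d i) (stdGaussian (EuclideanSpace ℝ (Fin d))) (P d))
    (hindep : ∀ d, iIndepFun (X d) (P d)) {γ : ℕ → ℝ}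
    (hγ : ∀ᶠ d : ℕ in atTop, Real.exp (-√(Real.log d)) ≤ γ d) :
    ∃ K : ℝ, 0 < K ∧ Tendsto (fun d : ℕ => P d {ω | K / √(Real.log d) <
      supFraction (P d) (W d) (X d) C₀ (γ d) ω}) atTop (𝓝 0) := by
  obtain ⟨M, hM0, hM⟩ := exists_abs_deriv_smoothTransition_le
  set B := √ψ₁ + |C| + 1 with hB
  have hB0 : 0 < B := by positivity
  set K := 32 * (2 * (ψ₁ + 1) + 2) / ψ₂ with hK
  have hK0 : 0 < K := by positivity
  set a := 4 * B ^ 3 * C₀ * M * C₀ with ha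
  set b := 2 * B ^ 2 * C₀ * (1 + C₀ ^ 2) with hb
  have hq := tendsto_sqrt_log_natCast_atTop
  have hexpq := Real.tendsto_exp_atTop.comp hq
  have hsqrtN : ∀ᶠ d : ℕ in atTop, √((N d : ℝ) / d) < √ψ₁ + 1 :=
    ((Real.continuous_sqrt.tendsto _).comp hN).eventually (gt_mem_nhds (by linarith))
  refine ⟨K, hK0, ?_⟩
  have hlim : Tendsto (fun d : ℕ => ENNReal.ofReal (Real.exp (-√(Real.log d)))) atTop (𝓝 0) := by
    rw [← ENNReal.ofReal_zero]
    exact ENNReal.tendsto_ofReal (Real.tendsto_exp_neg_atTop_nhds_zero.comp hq)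
  refine tendsto_of_tendsto_of_tendsto_of_le_of_le' tendsto_const_nhds hlim
    (.of_forall fun _ => zero_le) ?_
  filter_upwards [hrows, hW, hγ, hsqrtN, hN.eventually (gt_mem_nhds (lt_add_one ψ₁)),
    hn.eventually (lt_mem_nhds (half_lt_self hψ₂)), eventually_ge_atTop 1,
    hq.eventually_ge_atTop 48, hq.eventually_ge_atTop (16 / K), hq.eventually_ge_atTop (ψ₂ / 2),
    hexpq.eventually_ge_atTop (2 * (a + b)),
    hexpq.eventually_ge_atTop (1 + 16 * B ^ 2 * C₀ ^ 2)]
    with d hrowsd hWd hγd hsqrtNd hNd hnd hd1 hq48 hqK hqψ hea heb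
  set q := √(Real.log d) with hqdef
  have hd1' : (1 : ℝ) ≤ d := by exact_mod_cast hd1
  have hd0 : (0 : ℝ) < d := by linarith
  have hlog : Real.log d = q ^ 2 := (Real.sq_sqrt (Real.log_nonneg hd1')).symm
  have hq0 : 0 < q := by linarith
  have hγ0 : 0 < γ d := (Real.exp_pos _).trans_le hγd
  have hBW : opNorm (W d) ≤ B := hWd.1.trans (by rw [hB]; linarith [le_abs_self C])
  -- The coarsest scale for which 8B²C₀ε ≤ γ follows from γ ≥ e^{-q}.
  set ε := Real.exp (-q) / (8 * B ^ 2 * C₀) with hε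
  have hdev : (4 * B ^ 3 * C₀ * M * (C₀ * √(Real.log d / d)) / Real.exp (-(q ^ 2 / 8)) ^ 2 +
      2 * B ^ 2 * C₀ * (1 + C₀ ^ 2) * Real.exp (-(q ^ 2 / 8))) / (γ d / 2) ≤
      Real.exp (-(q ^ 2 / 16)) := by
    rw [sqrt_log_div_eq hd0 hq0.le hlog, ← mul_assoc _ C₀]
    exact deviation_bound_le hq48 (by positivity) (by positivity) hea hγd
  refine (measure_lt_supFraction_le (hX d) (hindep d) hrowsd hBW hC₀.le hM (Real.exp_pos _) hγ0
    (ε := ε) (by positivity) ?_ (Real.exp_pos _) (Real.exp_le_one_iff.2 (by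
      have : 0 ≤ q ^ 2 / 16 := by positivity
      linarith)) hdev (δ := K / q) (by positivity)).trans (ENNReal.ofReal_le_ofReal ?_)
  · rw [hε, mul_div_cancel₀ _ (by positivity)]
    exact hγd
  · have hbase : 1 + 2 * C₀ / ε = 1 + 16 * B ^ 2 * C₀ ^ 2 * Real.exp q := by
      rw [hε, Real.exp_neg]
      field_simp
      ring
    rw [hbase]
    refine union_bound_le hd1' hq0 (by positivity) heb hψ₂ ?_ ?_ hK ?_ hqψ
    · exact ((div_lt_iff₀ hd0).1 hNd).le
    · exact ((lt_div_iff₀ hd0).1 hnd).le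
    · rw [mul_comm]; exact (div_le_iff₀ hK0).1 hqK

/-- Here log(dγ²) = q² - 2r with |r| ≤ q/4 eventually, so it is positive and comparable with q². The
factor 2² is what turns K into 2K in the rate of part (a). -/
lemma InvIsExpLittleOSqrtLog.eventually {γ : ℕ → ℝ} (hγ : InvIsExpLittleOSqrtLog γ) :
    ∀ᶠ d : ℕ in atTop, Real.exp (-√(Real.log d)) ≤ γ d ∧ 0 < Real.log (d * γ d ^ 2) ∧
      Real.log (d * γ d ^ 2) ≤ 2 ^ 2 * Real.log d := by
  obtain ⟨r, hr, hγr⟩ := hγ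
  have hq := tendsto_sqrt_log_natCast_atTop
  filter_upwards [hγr, hr.bound (c := 1 / 4) (by norm_num), hq.eventually_ge_atTop 1,
    eventually_ge_atTop 1] with d h1 h2 hq1 hd1
  have hd1' : (1 : ℝ) ≤ d := by exact_mod_cast hd1
  have hγd : γ d = Real.exp (-r d) := by
    rw [Real.exp_neg, ← h1, one_div, inv_inv]
  rw [Real.norm_eq_abs, Real.norm_of_nonneg (Real.sqrt_nonneg _)] at h2
  set q := √(Real.log d)
  have hlog : Real.log d = q ^ 2 := (Real.sq_sqrt (Real.log_nonneg hd1')).symm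
  have h3 : Real.log (d * γ d ^ 2) = q ^ 2 - 2 * r d := by
    rw [Real.log_mul (by positivity) (by rw [hγd]; positivity), hlog, Real.log_pow, hγd,
      Real.log_exp]
    push_cast; ring
  have h4 := abs_le.1 h2
  rw [h3, hlog, hγd]
  refine ⟨Real.exp_le_exp.2 (by linarith [h4.2]), ?_, ?_⟩ <;> nlinarith [h4.1, h4.2]

theorem isBigOInProbability_supFraction (hψ₁ : 0 < ψ₁) (hψ₂ : 0 < ψ₂)
    (hN : Tendsto (fun d : ℕ => (N d : ℝ) / d) atTop (𝓝 ψ₁))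
    (hn : Tendsto (fun d : ℕ => (n d : ℝ) / d) atTop (𝓝 ψ₂)) (hC₀ : 0 < C₀)
    (hrows : ∀ᶠ d in atTop, UnitRows (W d)) (hW : ∀ᶠ d in atTop, EventW C (W d))
    (hX : ∀ d i, HasLaw (X d i) (stdGaussian (EuclideanSpace ℝ (Fin d))) (P d))
    (hindep : ∀ d, iIndepFun (X d) (P d)) {γ : ℕ → ℝ} (hγ : InvIsExpLittleOSqrtLog γ) :
    IsBigOInProbability P (fun d => supFraction (P d) (W d) (X d) C₀ (γ d))
      (fun d => Real.log (d * γ d ^ 2) ^ (-(1 / 2) : ℝ)) := by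
  intro ε hε
  obtain ⟨K, hK, hlim⟩ := exists_tendsto_measure_lt_supFraction hψ₁ hψ₂ hN hn hC₀ hrows hW hX
    hindep (hγ.eventually.mono fun d h => h.1)
  refine ⟨2 * K, by positivity, eventually_atTop.1 ?_⟩
  filter_upwards [hlim.eventually (gt_mem_nhds (ENNReal.ofReal_pos.2 hε)), hγ.eventually,
    tendsto_sqrt_log_natCast_atTop.eventually_gt_atTop 0] with d hPd hγd hq
  refine (measure_mono fun ω hω => ?_).trans hPd.le
  rw [Set.mem_ofPred_eq] at hω ⊢
  have hf := supFraction_nonneg (P := P d) (W := W d) (X := X d) (C₀ := C₀) (γ d) ω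
  set f := supFraction (P d) (W d) (X d) C₀ (γ d) ω
  rw [Real.rpow_neg hγd.2.1.le, ← Real.sqrt_eq_rpow, div_inv_eq_mul,
    abs_of_nonneg (by positivity)] at hω
  have hs : √(Real.log (d * γ d ^ 2)) ≤ 2 * √(Real.log d) := by
    have := Real.sqrt_le_sqrt hγd.2.2
    rwa [Real.sqrt_mul (by norm_num), Real.sqrt_sq (by norm_num)] at this
  rw [div_lt_iff₀ hq]
  have := mul_le_mul_of_nonneg_left hs hf
  linarith

theorem isLittleOInProbability_supFraction (hψ₁ : 0 < ψ₁) (hψ₂ : 0 < ψ₂)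
    (hN : Tendsto (fun d : ℕ => (N d : ℝ) / d) atTop (𝓝 ψ₁))
    (hn : Tendsto (fun d : ℕ => (n d : ℝ) / d) atTop (𝓝 ψ₂)) (hC₀ : 0 < C₀)
    (hrows : ∀ᶠ d in atTop, UnitRows (W d)) (hW : ∀ᶠ d in atTop, EventW C (W d))
    (hX : ∀ d i, HasLaw (X d i) (stdGaussian (EuclideanSpace ℝ (Fin d))) (P d))
    (hindep : ∀ d, iIndepFun (X d) (P d)) :
    IsLittleOInProbability P (fun d => supFraction (P d) (W d) (X d) C₀ (1 / Real.log d))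
      (fun _ => 1) := by
  intro ε hε
  have hq := tendsto_sqrt_log_natCast_atTop
  -- This amounts to q² e^{-q} ≤ 1 for large q.
  have hγ : ∀ᶠ d : ℕ in atTop, Real.exp (-√(Real.log d)) ≤ 1 / Real.log d := by
    filter_upwards [((Real.tendsto_pow_mul_exp_neg_atTop_nhds_zero 2).comp hq).eventually
      (gt_mem_nhds zero_lt_one), eventually_gt_atTop 1] with d h1 hd
    have hlog : 0 < Real.log d := Real.log_pos (by exact_mod_cast hd)
    simp only [Function.comp_apply, Real.sq_sqrt hlog.le] at h1
    rw [le_div_iff₀ hlog, mul_comm]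
    exact h1.le
  obtain ⟨K, hK, hlim⟩ := exists_tendsto_measure_lt_supFraction hψ₁ hψ₂ hN hn hC₀ hrows hW hX
    hindep hγ
  refine tendsto_of_tendsto_of_tendsto_of_le_of_le' tendsto_const_nhds hlim
    (.of_forall fun _ => zero_le) ?_
  filter_upwards [hq.eventually_gt_atTop 0, hq.eventually_ge_atTop (K / ε)] with d hq0 hqK
  refine measure_mono fun ω hω => ?_
  rw [Set.mem_ofPred_eq, div_one, abs_of_nonneg (supFraction_nonneg _ _)] at hω
  refine lt_of_le_of_lt ?_ hω
  rw [div_le_iff₀ hq0, mul_comm]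
  exact (div_le_iff₀ hε).1 hqK

end Asymptotics

end RandomFeatures

theorem mainTheorem5
    (N n : ℕ → ℕ) (ψ₁ ψ₂ : ℝ) (hψ₁ : 0 < ψ₁) (hψ₂ : 0 < ψ₂)
    (hN : Tendsto (fun d : ℕ => (N d : ℝ) / d) atTop (𝓝 ψ₁))
    (hn : Tendsto (fun d : ℕ => (n d : ℝ) / d) atTop (𝓝 ψ₂))
    (C C₀ : ℝ) (hC₀ : 0 < C₀)
    (W : ∀ d, Matrix (Fin (N d)) (Fin d) ℝ)
    (hrows : ∀ᶠ d in atTop, RandomFeatures.UnitRows (W d))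
    (hW : ∀ᶠ d in atTop, RandomFeatures.EventW C (W d))
    {Ω : ℕ → Type*} [∀ d, MeasurableSpace (Ω d)]
    (P : ∀ d, Measure (Ω d)) [∀ d, IsProbabilityMeasure (P d)]
    (X : ∀ d, Fin (n d) → Ω d → EuclideanSpace ℝ (Fin d))
    (hX : ∀ d i, HasLaw (X d i) (stdGaussian (EuclideanSpace ℝ (Fin d))) (P d))
    (hindep : ∀ d, iIndepFun (X d) (P d)) :
    (∀ γ : ℕ → ℝ, RandomFeatures.InvIsExpLittleOSqrtLog γ →
      RandomFeatures.IsBigOInProbability P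
        (fun d => RandomFeatures.supFraction (P d) (W d) (X d) C₀ (γ d))
        (fun d => Real.log (d * γ d ^ 2) ^ (-(1 / 2) : ℝ))) ∧
    RandomFeatures.IsLittleOInProbability P
      (fun d => RandomFeatures.supFraction (P d) (W d) (X d) C₀ (1 / Real.log d))
      (fun _ => 1) := by
  exact ⟨fun _ hγ => RandomFeatures.isBigOInProbability_supFraction hψ₁ hψ₂ hN hn hC₀ hrows hW hX
    hindep hγ, RandomFeatures.isLittleOInProbability_supFraction hψ₁ hψ₂ hN hn hC₀ hrows hW hX hindep⟩
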